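/- Let $\rho,\mu$ be Borel probability measures on $\mathbb{R}^d$ whose supports are contained in compact sets $\mathcal X,\mathcal Y\subset\mathbb{R}^d$ respectively. A set is called Lipschitz-path connected if any two of its points are joined by a Lipschitz curve $[0,1]\to\mathbb{R}^d$ with values in the set. Let $\operatorname{supp}\rho=\bigcup_{i\in I}A_i$ and $\operatorname{supp}\mu=\bigcup_{j\in J}B_j$ be finite unions of Lipschitz-path connected sets (for instance their Lipschitz-path components). Let $\Pi(\rho,\mu)$ be the set of Borel measures on $\mathbb{R}^d\times\mathbb{R}^d$ with marginals $\rho$ and $\mu$. Let $\Gamma$ be the set of optimal plans for the quadratic cost, i.e. of minimisers of $\int\|x-y\|^2\,d\gamma(x,y)$ over $\gamma\in\Pi(\rho,\mu)$, and write $\operatorname{supp}\Gamma=\bigcup_{\gamma\in\Gamma}\operatorname{supp}\gamma$. Let $G$ be the bipartite graph with vertices $(A_i)_{i\in I}$ and $(B_j)_{j\in J}$ (one vertex for each index) in which $A_i$ and $B_j$ are joined if and only if $\gamma(A_i\times B_j)>0$ for some $\gamma\in\Gamma$. (If the sets are not measurable, $\gamma$ is understood as the outer measure.) Assume that $G$ has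 exactly two connected components $G_0$ and $G_1$. For $k\in\{0,1\}$, write $(x,y)\in\operatorname{supp}\Gamma\cap G_k$ if $(x,y)\in\operatorname{supp}\Gamma$, $x$ belongs to some vertex $A_i$ of $G_k$, and $y$ belongs to some vertex $B_j$ of $G_k$. A Brenier potential is a function $\phi:\mathcal X\to\mathbb{R}$ of the form $$\phi(x)=\psi^*(x)=\sup_{y\in\mathcal Y}\bigl(\langle x,y\rangle-\psi(y)\bigr),$$ where $\psi$ minimises $\int_{\mathcal X}\psi^*\,d\rho+\int_{\mathcal Y}\psi\,d\mu$ over all continuous functions $\psi:\mathcal Y\to\mathbb{R}$. Then any two Brenier potentials $\phi_0,\phi_1$ satisfy $$\inf_{\lambda\in\mathbb{R}}\|\phi_0-\phi_1-\lambda\|_\infty\;\le\;\frac12\inf_{\substack{(x_0,y_0)\in\operatorname{supp}\Gamma\cap G_0\\(x_1,y_1)\in\operatorname{supp}\Gamma\cap G_1}}\langle x_1-x_0,\,y_1-y_0\rangle,$$ where $\|f\|_\infty=\sup_{x\in\operatorname{supp}\rho}|f(x)|$ and the infimum of the empty set is $+\infty$. -/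

import Mathlib

open MeasureTheory Set
open scoped ENNReal NNReal

noncomputable section

namespace OptimalTransport

/-- `Ω` is Lipschitz-path connected: any two of its points are joined by a curve
`[0, 1] → Ω` of finite length, which may be taken parametrised with constant speed, that is,
Lipschitz. -/
def IsLipschitzPathConnected {E : Type*} [PseudoEMetricSpace E] (Ω : Set E) : Prop :=
  ∀ x₀ ∈ Ω, ∀ x₁ ∈ Ω, ∃ (K : ℝ≥0) (ω : ℝ → E),
    LipschitzOnWith K ω (Icc 0 1) ∧ MapsTo ω (Icc 0 1) Ω ∧ ω 0 = x₀ ∧ ω 1 = x₁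

section Plans

variable {E : Type*} [NormedAddCommGroup E] [MeasurableSpace E]

/-- `γ ∈ Π(ρ, μ)`: the first marginal of `γ` is `ρ` and the second one is `μ`. -/
def IsTransportPlan (ρ μ : Measure E) (γ : Measure (E × E)) : Prop :=
  γ.fst = ρ ∧ γ.snd = μ

/-- The cost `∫ ‖x - y‖² dγ(x, y)`, with values in `[0, ∞]`. -/
def quadraticCost (γ : Measure (E × E)) : ℝ≥0∞ :=
  ∫⁻ p, ENNReal.ofReal (‖p.1 - p.2‖ ^ 2) ∂γ

/-- `γ` is an optimal transport plan from `ρ` to `μ` for the cost `c(x, y) = ‖x - y‖²`. -/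
def IsOptimalPlan (ρ μ : Measure E) (γ : Measure (E × E)) : Prop :=
  IsTransportPlan ρ μ γ ∧
    ∀ γ' : Measure (E × E), IsTransportPlan ρ μ γ' → quadraticCost γ ≤ quadraticCost γ'

/-- `supp Γ`, the union of the supports of all optimal plans. -/
def optimalSupport (ρ μ : Measure E) : Set (E × E) :=
  {p | ∃ γ : Measure (E × E), IsOptimalPlan ρ μ γ ∧ p ∈ γ.support}

/-- The bipartite graph whose vertices are the (indices of the) sets `A i` and `B j`, where `A i`
and `B j` are joined if and only if some optimal plan `γ` has `γ (A i × B j) > 0`. -/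
def supportGraph (ρ μ : Measure E) {I J : Type*} (A : I → Set E) (B : J → Set E) :
    SimpleGraph (I ⊕ J) where
  Adj u v := ∃ i j, ((u = Sum.inl i ∧ v = Sum.inr j) ∨ (u = Sum.inr j ∧ v = Sum.inl i)) ∧
    ∃ γ : Measure (E × E), IsOptimalPlan ρ μ γ ∧ 0 < γ (A i ×ˢ B j)
  symm := ⟨by
    rintro u v ⟨i, j, h, hγ⟩
    exact ⟨i, j, h.symm.imp And.symm And.symm, hγ⟩⟩
  loopless := ⟨by
    rintro u ⟨i, j, ⟨h, h'⟩ | ⟨h, h'⟩, -⟩ <;> simp [h] at h'⟩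

/-- The pairs `(x, y) ∈ supp Γ ∩ C`, for a connected component `C` of the graph: `x` belongs to
some `A i` and `y` to some `B j` that are vertices of `C`. -/
def supportPairs (ρ μ : Measure E) {I J : Type*} (A : I → Set E) (B : J → Set E)
    (C : (supportGraph ρ μ A B).ConnectedComponent) : Set (E × E) :=
  {p | p ∈ optimalSupport ρ μ ∧
    (∃ i, Sum.inl i ∈ C.supp ∧ p.1 ∈ A i) ∧ (∃ j, Sum.inr j ∈ C.supp ∧ p.2 ∈ B j)}

end Plans

section Potentials

variable {E : Type*} [NormedAddCommGroup E] [InnerProductSpace ℝ E] [MeasurableSpace E]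

/-- The Legendre transform `ψ^*(x) = sup_{y ∈ Y} ⟨x, y⟩ - ψ(y)` of a function on `Y`. It is used
only for `Y` compact and nonempty and `ψ` continuous on `Y`, where the supremum is attained. -/
def legendre (Y : Set E) (ψ : E → ℝ) (x : E) : ℝ :=
  ⨆ y : Y, (inner ℝ x (y : E) - ψ y)

/-- The objective `∫_X ψ^* dρ + ∫_Y ψ dμ` of the (semi-)dual problem. -/
def dualObjective (ρ μ : Measure E) (X Y : Set E) (ψ : E → ℝ) : ℝ :=
  (∫ x in X, legendre Y ψ x ∂ρ) + ∫ y in Y, ψ y ∂μ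

/-- A Brenier potential on `X`: a function `φ = ψ^*` where `ψ` minimises
`∫_X ψ^* dρ + ∫_Y ψ dμ` among all continuous functions on `Y`. -/
def IsBrenierPotential (ρ μ : Measure E) (X Y : Set E) (φ : E → ℝ) : Prop :=
  ∃ ψ : E → ℝ, ContinuousOn ψ Y ∧
    (∀ ψ' : E → ℝ, ContinuousOn ψ' Y →
      dualObjective ρ μ X Y ψ ≤ dualObjective ρ μ X Y ψ') ∧
    ∀ x ∈ X, φ x = legendre Y ψ x

end Potentials

/-- The uniform norm `‖f‖_∞ = sup_{x ∈ S} |f x|` on `S`, as an extended real number. -/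
def uniformNorm {E : Type*} (S : Set E) (f : E → ℝ) : EReal :=
  ⨆ x ∈ S, ((|f x| : ℝ) : EReal)

end OptimalTransport

end

/-! By Kantorovich duality, every dual minimiser `ψ` satisfies `ψ^*(x) + ψ(y) = ⟨x, y⟩` on the
support of every optimal plan (`IsOptimalPlan.legendre_add_eq_inner`). So each point of `supp ρ`
carries a subgradient common to both Brenier potentials. Along a Lipschitz curve in `supp ρ` they
therefore have the same derivative almost everywhere, and their difference is constant on each `A i`
(`sub_eq_sub_of_common_subgradients`). By symmetry, `ψ₁ - ψ₀` is constant on each `B j`. The two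
differences agree at contact points, so these constants propagate along edges: `φ₀ - φ₁` takes one
value `c₀` on `G₀` and one value `c₁` on `G₁` (`eq_of_reachable`).

Given contact pairs `(x₀, y₀)` and `(x₁, y₁)`, the increment from `x₀` to `x₁` of either potential
lies between `⟨x₁ - x₀, y₀⟩` and `⟨x₁ - x₀, y₁⟩`. Hence `|c₀ - c₁| ≤ ⟨x₁ - x₀, y₁ - y₀⟩`, and taking
`λ` as the midpoint of `c₀` and `c₁` gives the factor `1/2`. -/

namespace OptimalTransport

/-! ### Subgradients along Lipschitz curves -/

section Subgradients

variable {E : Type*} [NormedAddCommGroup E] [InnerProductSpace ℝ E]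

/-- `y` is a subgradient at `x` of the restriction of `f` to `S`. -/
def IsSubgradientOn (S : Set E) (f : E → ℝ) (x y : E) : Prop :=
  ∀ x' ∈ S, f x + inner ℝ y (x' - x) ≤ f x'

theorem lipschitzOnWith_of_isSubgradientOn {S : Set E} {f : E → ℝ} {R : ℝ≥0}
    (h : ∀ x ∈ S, ∃ y, ‖y‖ ≤ R ∧ IsSubgradientOn S f x y) : LipschitzOnWith R f S := by
  refine LipschitzOnWith.of_le_add_mul R fun x hx x' hx' => ?_
  obtain ⟨y, hy, hs⟩ := h x hx
  have h1 := hs x' hx'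
  have h2 : -inner ℝ y (x' - x) ≤ ‖y‖ * ‖x' - x‖ :=
    (neg_le_abs _).trans (abs_real_inner_le_norm _ _)
  have h3 : ‖y‖ * ‖x' - x‖ ≤ R * dist x x' := by
    rw [dist_comm, dist_eq_norm]
    gcongr
  linarith

/-- Along a curve, the derivative of a function is determined by any of its subgradients. -/
theorem IsSubgradientOn.hasDerivAt_comp {S : Set E} {f : E → ℝ} {ω : ℝ → E} {t : ℝ} {y : E}
    (hy : IsSubgradientOn S f (ω t) y) (hω : DifferentiableAt ℝ ω t)
    (hS : ∀ᶠ s in nhds t, ω s ∈ S) (hf : DifferentiableAt ℝ (f ∘ ω) t) :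
    HasDerivAt (f ∘ ω) (inner ℝ y (deriv ω t)) t := by
  have h1 : HasDerivAt (fun s => inner ℝ y (ω s)) (inner ℝ y (deriv ω t)) t := by
    simpa using (hasDerivAt_const t y).inner ℝ hω.hasDerivAt
  have h2 : HasDerivAt (fun s => (f ∘ ω) s - inner ℝ y (ω s))
      (deriv (f ∘ ω) t - inner ℝ y (deriv ω t)) t := hf.hasDerivAt.sub h1
  -- The subgradient inequality says that `f - ⟨y, ·⟩` is minimal over `S` at `ω t`.
  have hmin : IsLocalMin (fun s => (f ∘ ω) s - inner ℝ y (ω s)) t := by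
    filter_upwards [hS] with s hs
    have := hy _ hs
    simp only [Function.comp, inner_sub_right] at this ⊢
    linarith
  have h3 := hmin.hasDerivAt_eq_zero h2
  rw [← sub_eq_zero.1 h3]
  exact hf.hasDerivAt

/-- Two functions which have common bounded subgradients at all points of `S` differ by a constant
along Lipschitz curves in `S`. -/
theorem sub_eq_sub_of_common_subgradients [FiniteDimensional ℝ E] {S : Set E} {f₀ f₁ : E → ℝ}
    {R : ℝ≥0}
    (h : ∀ x ∈ S, ∃ y, ‖y‖ ≤ R ∧ IsSubgradientOn S f₀ x y ∧ IsSubgradientOn S f₁ x y)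
    {K : ℝ≥0} {ω : ℝ → E} (hω : LipschitzOnWith K ω (Icc 0 1)) (hS : MapsTo ω (Icc 0 1) S) :
    f₀ (ω 0) - f₁ (ω 0) = f₀ (ω 1) - f₁ (ω 1) := by
  have L₀ : LipschitzOnWith (R * K) (f₀ ∘ ω) (Icc 0 1) :=
    (lipschitzOnWith_of_isSubgradientOn fun x hx =>
      let ⟨y, h1, h2, _⟩ := h x hx; ⟨y, h1, h2⟩).comp hω hS
  have L₁ : LipschitzOnWith (R * K) (f₁ ∘ ω) (Icc 0 1) :=
    (lipschitzOnWith_of_isSubgradientOn fun x hx =>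
      let ⟨y, h1, _, h2⟩ := h x hx; ⟨y, h1, h2⟩).comp hω hS
  have hI : uIcc (0 : ℝ) 1 = Icc 0 1 := uIcc_of_le zero_le_one
  have hac : AbsolutelyContinuousOnInterval (f₀ ∘ ω - f₁ ∘ ω) 0 1 :=
    (LipschitzOnWith.absolutelyContinuousOnInterval (hI ▸ L₀)).sub
      (LipschitzOnWith.absolutelyContinuousOnInterval (hI ▸ L₁))
  have hd : ∀ᵐ t, t ∈ uIcc (0 : ℝ) 1 → HasDerivAt (f₀ ∘ ω - f₁ ∘ ω) 0 t := by
    -- Endpoints are discarded so that derivatives within `[0, 1]` become two-sided.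
    have h0 : ∀ᵐ t : ℝ, t ≠ 0 := by simp [ae_iff, measure_singleton]
    have h1 : ∀ᵐ t : ℝ, t ≠ 1 := by simp [ae_iff, measure_singleton]
    filter_upwards [h0, h1, L₀.ae_differentiableWithinAt_of_mem_real,
      L₁.ae_differentiableWithinAt_of_mem_real, hω.ae_differentiableWithinAt_of_mem_real]
      with t ht0 ht1 hd₀ hd₁ hdω ht
    rw [hI] at ht
    have hnhds : Icc (0 : ℝ) 1 ∈ nhds t :=
      Icc_mem_nhds (lt_of_le_of_ne ht.1 ht0.symm) (lt_of_le_of_ne ht.2 ht1)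
    obtain ⟨y, -, hy₀, hy₁⟩ := h _ (hS ht)
    have hev : ∀ᶠ s in nhds t, ω s ∈ S := by
      filter_upwards [hnhds] with s hs using hS hs
    have hω' := (hdω ht).differentiableAt hnhds
    simpa using (hy₀.hasDerivAt_comp hω' hev ((hd₀ ht).differentiableAt hnhds)).sub
      (hy₁.hasDerivAt_comp hω' hev ((hd₁ ht).differentiableAt hnhds))
  obtain ⟨C, hC⟩ := hac.const_of_ae_hasDerivAt_zero hd
  simpa using (hC 0 (by simp)).trans (hC 1 (by simp)).symm

theorem IsLipschitzPathConnected.sub_eq_sub [FiniteDimensional ℝ E] {S A : Set E}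
    (hA : IsLipschitzPathConnected A) (hAS : A ⊆ S) {f₀ f₁ : E → ℝ} {R : ℝ≥0}
    (h : ∀ x ∈ S, ∃ y, ‖y‖ ≤ R ∧ IsSubgradientOn S f₀ x y ∧ IsSubgradientOn S f₁ x y)
    {x x' : E} (hx : x ∈ A) (hx' : x' ∈ A) : f₀ x - f₁ x = f₀ x' - f₁ x' := by
  obtain ⟨K, ω, hω, hm, rfl, rfl⟩ := hA x hx x' hx'
  exact sub_eq_sub_of_common_subgradients h hω (hm.mono_right hAS)

end Subgradients

/-! ### Kantorovich duality via Hahn–Banach and Riesz -/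

section Duality

/-- **Hahn–Banach**: a sublinear functional is the maximum of the linear functionals below it. -/
theorem exists_linearMap_eq_of_sublinear {V : Type*} [AddCommGroup V] [Module ℝ V] (N : V → ℝ)
    (N_hom : ∀ c : ℝ, 0 < c → ∀ x, N (c • x) = c * N x) (N_add : ∀ x y, N (x + y) ≤ N x + N y)
    (v : V) : ∃ g : V →ₗ[ℝ] ℝ, g v = N v ∧ ∀ x, g x ≤ N x := by
  have N_0 : N 0 = 0 := by grind [N_hom 2 (by norm_num) 0, smul_zero]
  have H : ∀ c : ℝ, c • v = 0 → (RingHom.id ℝ) c • N v = 0 := by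
    intro c hc
    rcases smul_eq_zero.1 hc with rfl | rfl <;> simp [N_0]
  obtain ⟨g, hg, hgN⟩ := exists_extension_of_le_sublinear
    (LinearPMap.mkSpanSingleton' v (N v) H) N N_hom N_add (by
      rintro ⟨x, hx⟩
      obtain ⟨c, rfl⟩ := Submodule.mem_span_singleton.1 hx
      rw [LinearPMap.mkSpanSingleton'_apply]
      simp only [RingHom.id_apply, smul_eq_mul]
      rcases lt_trichotomy c 0 with hc | rfl | hc
      -- For `c < 0`, `0 = N 0 ≤ N (c • v) + N (-c • v)` gives `c * N v ≤ N (c • v)`.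
      · have h1 := N_hom (-c) (neg_pos.2 hc) v
        have h2 := N_add (c • v) ((-c) • v)
        rw [← add_smul, add_neg_cancel, zero_smul, N_0] at h2
        linarith
      · simp [N_0]
      · exact (N_hom c hc v).ge)
  refine ⟨g, ?_, hgN⟩
  exact (hg ⟨v, Submodule.mem_span_singleton_self v⟩).trans
    (LinearPMap.mkSpanSingleton'_apply_self v (N v) H _)

/-- A positive linear functional on `C(X, ℝ)`, for compact `X`, is the integral against a finite
measure. -/
theorem exists_measure_integral_eq {X : Type*} [TopologicalSpace X] [T2Space X] [CompactSpace X]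
    [MeasurableSpace X] [BorelSpace X] (L : C(X, ℝ) →ₗ[ℝ] ℝ) (hL : ∀ f, 0 ≤ f → 0 ≤ L f) :
    ∃ γ : Measure X, IsFiniteMeasure γ ∧ ∀ f : C(X, ℝ), ∫ x, f x ∂γ = L f := by
  let Λ : CompactlySupportedContinuousMap X ℝ →ₚ[ℝ] ℝ := PositiveLinearMap.mk₀
    { toFun := fun f => L f.toContinuousMap
      map_add' := fun f g => L.map_add _ _
      map_smul' := fun c f => L.map_smul _ _ } (fun f hf => hL _ hf)
  refine ⟨RealRMK.rieszMeasure Λ, inferInstance, fun f => ?_⟩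
  exact RealRMK.integral_rieszMeasure Λ (CompactlySupportedContinuousMap.continuousMapEquiv f)

variable {α β : Type*} [TopologicalSpace α] [CompactSpace α] [MeasurableSpace α]
  [TopologicalSpace β] [CompactSpace β] [MeasurableSpace β]

/-- The values of the dual problem to the maximisation of `∫ h dγ` over plans `γ`. -/
def dualValues (ρ : Measure α) (μ : Measure β) (h : C(α × β, ℝ)) : Set ℝ :=
  {r | ∃ (f : C(α, ℝ)) (g : C(β, ℝ)), (∀ a b, h (a, b) ≤ f a + g b) ∧
    r = ∫ a, f a ∂ρ + ∫ b, g b ∂μ}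

theorem nonempty_dualValues (ρ : Measure α) (μ : Measure β)
    (h : C(α × β, ℝ)) : (dualValues ρ μ h).Nonempty :=
  ⟨_, ContinuousMap.const _ ‖h‖, 0, fun a b => by simpa using h.apply_le_norm (a, b), rfl⟩

variable [BorelSpace α] [BorelSpace β] (ρ : Measure α) (μ : Measure β)
  [IsProbabilityMeasure ρ] [IsProbabilityMeasure μ]

theorem _root_.ContinuousMap.integrable_of_compactSpace {X : Type*} [TopologicalSpace X]
    [CompactSpace X] [MeasurableSpace X] [BorelSpace X] {ν : Measure X} [IsFiniteMeasure ν]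
    (f : C(X, ℝ)) : Integrable f ν := by
  exact (BoundedContinuousFunction.mkOfCompact f).integrable ν

/-- Integrating the constraint in one variable at a time gives the bound. It makes the dual infimum
finite. -/
theorem le_of_mem_dualValues {h : C(α × β, ℝ)} {m r : ℝ} (hm : ∀ p, m ≤ h p)
    (hr : r ∈ dualValues ρ μ h) : m ≤ r := by
  obtain ⟨f, g, hfg, rfl⟩ := hr
  have h1 : ∀ b, m - g b ≤ ∫ a, f a ∂ρ := fun b => by
    have := integral_mono (μ := ρ) (integrable_const (m - g b)) f.integrable_of_compactSpace
      (fun a => by have := hfg a b; have := hm (a, b); simp only; linarith)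
    simpa using this
  have h2 := integral_mono (μ := μ) (integrable_const (m - ∫ a, f a ∂ρ))
    g.integrable_of_compactSpace (fun b => by have := h1 b; simp only; linarith)
  simp only [integral_const, probReal_univ, one_smul] at h2
  linarith

theorem bddBelow_dualValues (h : C(α × β, ℝ)) : BddBelow (dualValues ρ μ h) :=
  ⟨-‖h‖, fun _ hr => le_of_mem_dualValues ρ μ (fun p => h.neg_norm_le_apply p) hr⟩

/-- **Kantorovich duality** on compact spaces: there is a plan whose value is the infimum of the
dual problem. -/
theorem exists_plan_dual_le [T2Space α] [T2Space β] [SecondCountableTopology α]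
    [SecondCountableTopology β] [HasOuterApproxClosed α] [HasOuterApproxClosed β]
    (c : C(α × β, ℝ)) :
    ∃ γ : Measure (α × β), IsFiniteMeasure γ ∧ γ.fst = ρ ∧ γ.snd = μ ∧
      sInf (dualValues ρ μ c) = ∫ p, c p ∂γ := by
  -- The dual value is sublinear in the cost. A linear functional below it that touches it at `c`
  -- will be integration against the desired plan.
  set N : C(α × β, ℝ) → ℝ := fun h => sInf (dualValues ρ μ h) with hN
  have N_le : ∀ {h r}, r ∈ dualValues ρ μ h → N h ≤ r := fun hr =>
    csInf_le (bddBelow_dualValues ρ μ _) hr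
  have le_N : ∀ {h : C(α × β, ℝ)} {m}, (∀ r ∈ dualValues ρ μ h, m ≤ r) → m ≤ N h := fun hr =>
    le_csInf (nonempty_dualValues ρ μ _) hr
  have N_add : ∀ h h', N (h + h') ≤ N h + N h' := by
    intro h h'
    rw [← sub_le_iff_le_add]
    refine le_N ?_
    rintro _ ⟨f, g, hfg, rfl⟩
    rw [sub_le_comm]
    refine le_N ?_
    rintro _ ⟨f', g', hfg', rfl⟩
    rw [sub_le_iff_le_add]
    refine N_le ⟨f + f', g + g', fun a b => ?_, ?_⟩
    · have := hfg a b; have := hfg' a b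
      simp only [ContinuousMap.add_apply]; linarith
    · simp only [ContinuousMap.add_apply]
      rw [integral_add f.integrable_of_compactSpace f'.integrable_of_compactSpace,
        integral_add g.integrable_of_compactSpace g'.integrable_of_compactSpace]
      ring
  have N_le_smul : ∀ t : ℝ, 0 < t → ∀ h, N (t • h) ≤ t * N h := by
    intro t ht h
    rw [← div_le_iff₀' ht]
    refine le_N ?_
    rintro _ ⟨f, g, hfg, rfl⟩
    rw [div_le_iff₀' ht]
    refine N_le ⟨t • f, t • g, fun a b => ?_, ?_⟩
    · simp only [ContinuousMap.smul_apply, smul_eq_mul, ← mul_add]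
      exact mul_le_mul_of_nonneg_left (hfg a b) ht.le
    · simp only [ContinuousMap.smul_apply, smul_eq_mul, integral_const_mul]
      ring
  have N_hom : ∀ t : ℝ, 0 < t → ∀ h, N (t • h) = t * N h := by
    intro t ht h
    refine le_antisymm (N_le_smul t ht h) ?_
    have := N_le_smul t⁻¹ (inv_pos.2 ht) (t • h)
    rw [inv_smul_smul₀ ht.ne'] at this
    rwa [← le_inv_mul_iff₀ ht]
  obtain ⟨L, hLc, hLN⟩ := exists_linearMap_eq_of_sublinear N N_hom N_add c
  -- For `h ≥ 0` the pair `(0, 0)` is admissible for `-h`, so `L (-h) ≤ N (-h) ≤ 0`.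
  have hLpos : ∀ h, 0 ≤ h → 0 ≤ L h := by
    intro h hh
    have h1 := hLN (-h)
    have h2 : N (-h) ≤ 0 := N_le ⟨0, 0, fun a b => by simpa using hh (a, b), by simp⟩
    rw [map_neg] at h1
    linarith
  obtain ⟨γ, hγ, hγL⟩ := exists_measure_integral_eq L hLpos
  -- The bound `L ≤ N` gives one inequality; replacing `f` by `-f` gives the other.
  have hL_fst : ∀ f : C(α, ℝ), L (f.comp ContinuousMap.fst) = ∫ a, f a ∂ρ := by
    have key : ∀ f : C(α, ℝ), L (f.comp ContinuousMap.fst) ≤ ∫ a, f a ∂ρ := fun f =>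
      (hLN _).trans (N_le ⟨f, 0, fun a b => by simp, by simp⟩)
    intro f
    refine le_antisymm (key f) ?_
    have h1 := key (-f)
    have h2 : (-f).comp (ContinuousMap.fst : C(α × β, α)) = -(f.comp ContinuousMap.fst) := rfl
    rw [h2, map_neg] at h1
    simp only [ContinuousMap.neg_apply, integral_neg] at h1
    linarith
  have hL_snd : ∀ g : C(β, ℝ), L (g.comp ContinuousMap.snd) = ∫ b, g b ∂μ := by
    have key : ∀ g : C(β, ℝ), L (g.comp ContinuousMap.snd) ≤ ∫ b, g b ∂μ := fun g =>
      (hLN _).trans (N_le ⟨0, g, fun a b => by simp, by simp⟩)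
    intro g
    refine le_antisymm (key g) ?_
    have h1 := key (-g)
    have h2 : (-g).comp (ContinuousMap.snd : C(α × β, β)) = -(g.comp ContinuousMap.snd) := rfl
    rw [h2, map_neg] at h1
    simp only [ContinuousMap.neg_apply, integral_neg] at h1
    linarith
  refine ⟨γ, hγ, ?_, ?_, by rw [hγL, hLc]⟩
  · refine ext_of_forall_integral_eq_of_IsFiniteMeasure fun f => ?_
    rw [Measure.fst, integral_map measurable_fst.aemeasurable
      f.continuous.aestronglyMeasurable]
    exact (hγL (f.toContinuousMap.comp ContinuousMap.fst)).trans (hL_fst f.toContinuousMap)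
  · refine ext_of_forall_integral_eq_of_IsFiniteMeasure fun f => ?_
    rw [Measure.snd, integral_map measurable_snd.aemeasurable
      f.continuous.aestronglyMeasurable]
    exact (hγL (f.toContinuousMap.comp ContinuousMap.snd)).trans (hL_snd f.toContinuousMap)

end Duality

/-! ### The Legendre transform and contact points -/

section Legendre

variable {E : Type*} [NormedAddCommGroup E] [InnerProductSpace ℝ E] {Y : Set E} {ψ : E → ℝ}

theorem bddAbove_legendre (hY : IsCompact Y) (hψ : ContinuousOn ψ Y) (x : E) :
    BddAbove (range fun y : Y => inner ℝ x (y : E) - ψ y) := by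
  have h : ContinuousOn (fun y => inner ℝ x y - ψ y) Y := by fun_prop
  have := hY.bddAbove_image h
  rwa [image_eq_range] at this

theorem inner_sub_le_legendre (hY : IsCompact Y) (hψ : ContinuousOn ψ Y) (x : E) {y : E}
    (hy : y ∈ Y) : inner ℝ x y - ψ y ≤ legendre Y ψ x :=
  le_ciSup (bddAbove_legendre hY hψ x) ⟨y, hy⟩

theorem legendre_le (hY : Y.Nonempty) {x : E} {m : ℝ} (h : ∀ y ∈ Y, inner ℝ x y - ψ y ≤ m) :
    legendre Y ψ x ≤ m :=
  haveI := hY.to_subtype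
  ciSup_le fun y => h y y.2

theorem continuous_legendre (hY : IsCompact Y) (hY' : Y.Nonempty) (hψ : ContinuousOn ψ Y) :
    Continuous (legendre Y ψ) := by
  obtain ⟨R, hR⟩ := hY.isBounded.exists_norm_le
  have hR0 : 0 ≤ R := hY'.elim fun y hy => (norm_nonneg y).trans (hR y hy)
  refine (LipschitzWith.of_le_add_mul ⟨R, hR0⟩ fun x x' => ?_).continuous
  refine legendre_le hY' fun y hy => ?_
  have h1 := inner_sub_le_legendre hY hψ x' hy
  have h2 : inner ℝ (x - x') y ≤ R * dist x x' := by
    rw [dist_eq_norm, mul_comm]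
    exact (real_inner_le_norm _ _).trans
      (mul_le_mul_of_nonneg_left (hR y hy) (norm_nonneg _))
  rw [inner_sub_left] at h2
  change _ ≤ _ + R * _
  linarith

/-- At a contact point, `y` is a subgradient of `ψ^*` at `x`. -/
theorem isSubgradientOn_legendre (hY : IsCompact Y) (hψ : ContinuousOn ψ Y) {x y : E} (hy : y ∈ Y)
    (hxy : legendre Y ψ x + ψ y = inner ℝ x y) (S : Set E) :
    IsSubgradientOn S (legendre Y ψ) x y := by
  intro x' _
  have := inner_sub_le_legendre hY hψ x' hy
  rw [inner_sub_right, real_inner_comm x' y, real_inner_comm x y]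
  linarith

/-- At a contact point, `x` is a subgradient of `ψ` at `y`. -/
theorem isSubgradientOn_of_legendre (hY : IsCompact Y) (hψ : ContinuousOn ψ Y) {x y : E}
    (hxy : legendre Y ψ x + ψ y = inner ℝ x y) {S : Set E} (hS : S ⊆ Y) :
    IsSubgradientOn S ψ y x := by
  intro y' hy'
  have := inner_sub_le_legendre hY hψ x (hS hy')
  rw [inner_sub_right]
  linarith

end Legendre

theorem integrable_of_ae_mem_compact {F : Type*} [TopologicalSpace F] [T2Space F]
    [MeasurableSpace F] [OpensMeasurableSpace F] {ν : Measure F} [IsFiniteMeasure ν] {K : Set F}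
    (hK : IsCompact K) (hν : ∀ᵐ p ∂ν, p ∈ K) {f : F → ℝ} (hf : ContinuousOn f K) :
    Integrable f ν := by
  rw [← Measure.restrict_eq_self_of_ae_mem hν]
  exact hf.integrableOn_compact hK

/-! ### Optimal plans and complementary slackness -/

section Plans

variable {E : Type*} [MeasurableSpace E]
  {ρ μ : Measure E} {X Y : Set E} {γ : Measure (E × E)}

theorem IsTransportPlan.isProbabilityMeasure [IsProbabilityMeasure ρ]
    (hγ : IsTransportPlan ρ μ γ) : IsProbabilityMeasure γ :=
  ⟨by rw [← Measure.fst_univ, hγ.1, measure_univ]⟩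

theorem IsTransportPlan.ae_mem (hγ : IsTransportPlan ρ μ γ) (hX : ∀ᵐ x ∂ρ, x ∈ X)
    (hY : ∀ᵐ y ∂μ, y ∈ Y) : ∀ᵐ p ∂γ, p ∈ X ×ˢ Y := by
  rw [← hγ.1] at hX
  rw [← hγ.2] at hY
  filter_upwards [ae_of_ae_map measurable_fst.aemeasurable hX,
    ae_of_ae_map measurable_snd.aemeasurable hY] with p h1 h2 using ⟨h1, h2⟩

variable [NormedAddCommGroup E] [SecondCountableTopology E]

theorem IsTransportPlan.support_subset (hγ : IsTransportPlan ρ μ γ) :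
    γ.support ⊆ ρ.support ×ˢ μ.support :=
  Measure.support_subset_of_isClosed (Measure.isClosed_support.prod Measure.isClosed_support)
    (hγ.ae_mem Measure.support_mem_ae Measure.support_mem_ae)

variable [BorelSpace E]

/-- By compactness the projection of `supp γ` is closed; it has full `ρ`-measure, so it contains
`supp ρ`. -/
theorem IsTransportPlan.exists_mem_support_left (hγ : IsTransportPlan ρ μ γ)
    (hρ : IsCompact ρ.support) (hμ : IsCompact μ.support) {x : E} (hx : x ∈ ρ.support) :
    ∃ y, (x, y) ∈ γ.support := by
  have hc : IsCompact γ.support :=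
    (hρ.prod hμ).of_isClosed_subset Measure.isClosed_support hγ.support_subset
  have hcl := (hc.image continuous_fst).isClosed
  have hsub : ρ.support ⊆ Prod.fst '' γ.support := by
    refine Measure.support_subset_of_isClosed hcl ?_
    rw [← hγ.1, Measure.fst]
    refine (mem_ae_map_iff measurable_fst.aemeasurable hcl.measurableSet).2 ?_
    exact Filter.mem_of_superset Measure.support_mem_ae (subset_preimage_image _ _)
  obtain ⟨⟨x', y⟩, h, rfl⟩ := hsub hx
  exact ⟨y, h⟩

theorem IsTransportPlan.exists_mem_support_right (hγ : IsTransportPlan ρ μ γ)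
    (hρ : IsCompact ρ.support) (hμ : IsCompact μ.support) {y : E} (hy : y ∈ μ.support) :
    ∃ x, (x, y) ∈ γ.support := by
  have hc : IsCompact γ.support :=
    (hρ.prod hμ).of_isClosed_subset Measure.isClosed_support hγ.support_subset
  have hcl := (hc.image continuous_snd).isClosed
  have hsub : μ.support ⊆ Prod.snd '' γ.support := by
    refine Measure.support_subset_of_isClosed hcl ?_
    rw [← hγ.2, Measure.snd]
    refine (mem_ae_map_iff measurable_snd.aemeasurable hcl.measurableSet).2 ?_
    exact Filter.mem_of_superset Measure.support_mem_ae (subset_preimage_image _ _)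
  obtain ⟨⟨x, y'⟩, h, rfl⟩ := hsub hy
  exact ⟨x, h⟩

variable [InnerProductSpace ℝ E]

/-- Expanding the square leaves only the cross term depending on the plan. The sign is recorded
because `ENNReal.ofReal` truncates negative numbers. -/
theorem IsTransportPlan.quadraticCost_eq [IsProbabilityMeasure ρ]
    (hγ : IsTransportPlan ρ μ γ) (hXc : IsCompact X) (hYc : IsCompact Y)
    (hX : ∀ᵐ x ∂ρ, x ∈ X) (hY : ∀ᵐ y ∂μ, y ∈ Y) :
    0 ≤ (∫ x, ‖x‖ ^ 2 ∂ρ) + (∫ y, ‖y‖ ^ 2 ∂μ) - 2 * ∫ p, inner ℝ p.1 p.2 ∂γ ∧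
    quadraticCost γ = ENNReal.ofReal
      ((∫ x, ‖x‖ ^ 2 ∂ρ) + (∫ y, ‖y‖ ^ 2 ∂μ) - 2 * ∫ p, inner ℝ p.1 p.2 ∂γ) := by
  have := hγ.isProbabilityMeasure
  have hae := hγ.ae_mem hX hY
  have hint : ∀ {f : E × E → ℝ}, Continuous f → Integrable f γ := fun hf =>
    integrable_of_ae_mem_compact (hXc.prod hYc) hae hf.continuousOn
  have h1 : ∫ x, ‖x‖ ^ 2 ∂ρ = ∫ p, ‖p.1‖ ^ 2 ∂γ := by
    rw [← hγ.1, Measure.fst, integral_map measurable_fst.aemeasurable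
      (by fun_prop : Continuous fun x : E => ‖x‖ ^ 2).aestronglyMeasurable]
  have h2 : ∫ y, ‖y‖ ^ 2 ∂μ = ∫ p, ‖p.2‖ ^ 2 ∂γ := by
    rw [← hγ.2, Measure.snd, integral_map measurable_snd.aemeasurable
      (by fun_prop : Continuous fun x : E => ‖x‖ ^ 2).aestronglyMeasurable]
  have h3 : ∫ p, ‖p.1 - p.2‖ ^ 2 ∂γ =
      (∫ x, ‖x‖ ^ 2 ∂ρ) + (∫ y, ‖y‖ ^ 2 ∂μ) - 2 * ∫ p, inner ℝ p.1 p.2 ∂γ := by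
    rw [h1, h2, ← integral_const_mul, ← integral_add (hint (by fun_prop)) (hint (by fun_prop)),
      ← integral_sub (hint (by fun_prop)) (hint (by fun_prop))]
    refine integral_congr_ae (ae_of_all _ fun p => ?_)
    simp only [norm_sub_sq_real]
    ring
  rw [← h3]
  exact ⟨integral_nonneg fun p => by positivity, (ofReal_integral_eq_lintegral_ofReal
    (hint (by fun_prop)) (ae_of_all _ fun p => by positivity)).symm⟩

/-- Optimal plans maximise `∫ ⟨x, y⟩ dγ`. -/
theorem IsOptimalPlan.integral_inner_le [IsProbabilityMeasure ρ]
    (hγ : IsOptimalPlan ρ μ γ) (hXc : IsCompact X) (hYc : IsCompact Y)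
    (hX : ∀ᵐ x ∂ρ, x ∈ X) (hY : ∀ᵐ y ∂μ, y ∈ Y) {γ' : Measure (E × E)}
    (hγ' : IsTransportPlan ρ μ γ') :
    ∫ p, inner ℝ p.1 p.2 ∂γ' ≤ ∫ p, inner ℝ p.1 p.2 ∂γ := by
  have h1 := hγ.2 γ' hγ'
  obtain ⟨h2, h3⟩ := hγ'.quadraticCost_eq hXc hYc hX hY
  rw [(hγ.1.quadraticCost_eq hXc hYc hX hY).2, h3, ENNReal.ofReal_le_ofReal_iff h2] at h1
  linarith

/-- Duality on the compact subtypes `X` and `Y`, carried back to `E`. An admissible pair `(f, g)`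
yields `ψ = g`, because admissibility gives `ψ^* ≤ f` on `X`. -/
theorem exists_plan_dualObjective_le [IsProbabilityMeasure ρ] [IsProbabilityMeasure μ]
    (hXc : IsCompact X) (hYc : IsCompact Y) (hX : ∀ᵐ x ∂ρ, x ∈ X) (hY : ∀ᵐ y ∂μ, y ∈ Y) :
    ∃ γ, IsTransportPlan ρ μ γ ∧ ∀ ε > 0, ∃ ψ : E → ℝ, ContinuousOn ψ Y ∧
      dualObjective ρ μ X Y ψ ≤ ∫ p, inner ℝ p.1 p.2 ∂γ + ε := by
  have hYne : Y.Nonempty := by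
    obtain ⟨y, hy⟩ := hY.exists
    exact ⟨y, hy⟩
  have : CompactSpace X := isCompact_iff_compactSpace.1 hXc
  have : CompactSpace Y := isCompact_iff_compactSpace.1 hYc
  have hmap : ∀ {Z : Set E} (ν : Measure E), MeasurableSet Z → (∀ᵐ z ∂ν, z ∈ Z) →
      (ν.comap ((↑) : Z → E)).map (↑) = ν := fun ν hZ h => by
    rw [map_comap_subtype_coe hZ, Measure.restrict_eq_self_of_ae_mem h]
  have hρ := hmap ρ hXc.measurableSet hX
  have hμ := hmap μ hYc.measurableSet hY
  have : IsProbabilityMeasure (ρ.comap ((↑) : X → E)) := by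
    refine ⟨?_⟩
    rw [← preimage_univ (f := ((↑) : X → E)),
      ← Measure.map_apply measurable_subtype_coe MeasurableSet.univ, hρ, measure_univ]
  have : IsProbabilityMeasure (μ.comap ((↑) : Y → E)) := by
    refine ⟨?_⟩
    rw [← preimage_univ (f := ((↑) : Y → E)),
      ← Measure.map_apply measurable_subtype_coe MeasurableSet.univ, hμ, measure_univ]
  obtain ⟨γ, hγ, hfst, hsnd, hval⟩ := exists_plan_dual_le (ρ.comap ((↑) : X → E))
    (μ.comap ((↑) : Y → E)) ⟨fun p => inner ℝ (p.1 : E) (p.2 : E), by fun_prop⟩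
  have hm : Measurable (Prod.map ((↑) : X → E) ((↑) : Y → E)) :=
    measurable_subtype_coe.prodMap measurable_subtype_coe
  refine ⟨γ.map (Prod.map (↑) (↑)), ⟨?_, ?_⟩, fun ε hε => ?_⟩
  · rw [Measure.fst, Measure.map_map measurable_fst hm, Prod.map_fst',
      ← Measure.map_map measurable_subtype_coe measurable_fst]
    exact (congrArg _ hfst).trans hρ
  · rw [Measure.snd, Measure.map_map measurable_snd hm, Prod.map_snd',
      ← Measure.map_map measurable_subtype_coe measurable_snd]
    exact (congrArg _ hsnd).trans hμ
  · rw [integral_map hm.aemeasurable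
      (by fun_prop : Continuous fun p : E × E => inner ℝ p.1 p.2).aestronglyMeasurable]
    obtain ⟨_, ⟨f, g, hfg, rfl⟩, hlt⟩ := exists_lt_of_csInf_lt
      (nonempty_dualValues (ρ.comap ((↑) : X → E)) (μ.comap ((↑) : Y → E)) _)
      (lt_add_of_pos_right _ hε)
    rw [hval] at hlt
    -- The value `0` off `Y` is irrelevant: only the restriction to `Y` enters the objective.
    have hext : ∀ y : Y, Function.extend ((↑) : Y → E) g 0 y = g y :=
      Subtype.val_injective.extend_apply g 0
    have hcont : ContinuousOn (Function.extend ((↑) : Y → E) g 0) Y := by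
      rw [continuousOn_iff_continuous_domRestrict]
      exact g.continuous.congr fun y => (hext y).symm
    refine ⟨_, hcont, le_trans (add_le_add ?_ ?_) hlt.le⟩
    · rw [← integral_subtype_comap hXc.measurableSet]
      refine integral_mono ?_ f.integrable_of_compactSpace fun x => ?_
      · exact ContinuousMap.integrable_of_compactSpace
          ⟨_, (continuous_legendre hYc hYne hcont).comp continuous_subtype_val⟩
      · refine legendre_le hYne fun y hy => ?_
        rw [hext ⟨y, hy⟩, sub_le_iff_le_add]
        exact hfg x ⟨y, hy⟩
    · rw [← integral_subtype_comap hYc.measurableSet]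
      simp only [hext, le_refl]

/-- The dual minimisers are in contact on the supports of the optimal plans. -/
theorem IsOptimalPlan.legendre_add_eq_inner [IsProbabilityMeasure ρ] [IsProbabilityMeasure μ]
    (hγ : IsOptimalPlan ρ μ γ) (hXc : IsCompact X) (hYc : IsCompact Y)
    (hX : ∀ᵐ x ∂ρ, x ∈ X) (hY : ∀ᵐ y ∂μ, y ∈ Y) {ψ : E → ℝ} (hψ : ContinuousOn ψ Y)
    (hmin : ∀ ψ' : E → ℝ, ContinuousOn ψ' Y →
      dualObjective ρ μ X Y ψ ≤ dualObjective ρ μ X Y ψ')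
    {p : E × E} (hp : p ∈ γ.support) (hpXY : p ∈ X ×ˢ Y) :
    legendre Y ψ p.1 + ψ p.2 = inner ℝ p.1 p.2 := by
  have := hγ.1.isProbabilityMeasure
  have hae := hγ.1.ae_mem hX hY
  have hleg : Continuous (legendre Y ψ) := continuous_legendre hYc ⟨_, hpXY.2⟩ hψ
  have hle : dualObjective ρ μ X Y ψ ≤ ∫ p, inner ℝ p.1 p.2 ∂γ := by
    obtain ⟨γ', hγ', hdual⟩ := exists_plan_dualObjective_le hXc hYc hX hY
    refine le_trans (le_of_forall_pos_le_add fun ε hε => ?_)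
      (hγ.integral_inner_le hXc hYc hX hY hγ')
    obtain ⟨ψ', hψ', h⟩ := hdual ε hε
    exact (hmin ψ' hψ').trans h
  set F : E × E → ℝ := fun q => legendre Y ψ q.1 + ψ q.2 - inner ℝ q.1 q.2 with hF
  have hψ2 : ContinuousOn (fun q : E × E => ψ q.2) (X ×ˢ Y) :=
    hψ.comp continuousOn_snd fun q hq => hq.2
  have hFc : ContinuousOn F (X ×ˢ Y) := by fun_prop
  have hint : ∀ {f : E × E → ℝ}, ContinuousOn f (X ×ˢ Y) → Integrable f γ := fun hf =>
    integrable_of_ae_mem_compact (hXc.prod hYc) hae hf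
  have hF0 : ∀ q ∈ X ×ˢ Y, 0 ≤ F q := fun q hq => by
    have := inner_sub_le_legendre hYc hψ q.1 hq.2
    simp only [hF]
    linarith
  have h1 : ∫ x in X, legendre Y ψ x ∂ρ = ∫ q, legendre Y ψ q.1 ∂γ := by
    rw [Measure.restrict_eq_self_of_ae_mem hX, ← hγ.1.1, Measure.fst,
      integral_map measurable_fst.aemeasurable hleg.aestronglyMeasurable]
  have h2 : ∫ y in Y, ψ y ∂μ = ∫ q, ψ q.2 ∂γ := by
    have hmeas : AEStronglyMeasurable ψ μ := (integrable_of_ae_mem_compact hYc hY hψ).1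
    rw [Measure.restrict_eq_self_of_ae_mem hY]
    rw [← hγ.1.2, Measure.snd] at hmeas ⊢
    rw [integral_map measurable_snd.aemeasurable hmeas]
  have hFint : ∫ q, F q ∂γ ≤ 0 := by
    rw [dualObjective, h1, h2, ← integral_add (hint (by fun_prop)) (hint hψ2)] at hle
    rw [hF, integral_sub (hint (by fun_prop)) (hint (by fun_prop))]
    linarith
  have hF0ae : 0 ≤ᵐ[γ] F := by filter_upwards [hae] with q hq using hF0 q hq
  have hFae : F =ᵐ[γ] 0 := (integral_eq_zero_iff_of_nonneg_ae hF0ae (hint hFc)).1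
    (le_antisymm hFint (integral_nonneg_of_ae hF0ae))
  by_contra hne
  have hpos : 0 < F p := lt_of_le_of_ne (hF0 p hpXY) fun h => hne (sub_eq_zero.1 h.symm)
  -- The gap `F` would be positive near `p` in `X × Y`, a neighbourhood charged by `γ`, whereas `F =
  -- 0` almost everywhere.
  have hev : ∀ᶠ q in nhdsWithin p (X ×ˢ Y), 0 < F q := (hFc p hpXY).eventually_const_lt hpos
  have hU := (Measure.mem_support_iff_forall p).1 hp _ (eventually_nhdsWithin_iff.1 hev)
  refine hU.ne' (measure_eq_zero_iff_ae_notMem.2 ?_)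
  filter_upwards [hae, hFae] with q hq hq0 hqU
  exact (hqU hq).ne' hq0

end Plans

/-! ### Constants on graph components and the final bound -/

section Components

variable {E : Type*} [NormedAddCommGroup E] [MeasurableSpace E] [SecondCountableTopology E]
  {ρ μ : Measure E} {I J : Type*} {A : I → Set E} {B : J → Set E}

/-- If `f` is constant on each `A i`, `g` on each `B j`, and `f x = g y` on the supports of the
optimal plans, then both are equal to one constant on each component of the graph. -/
theorem eq_of_reachable {f g : E → ℝ} (hf : ∀ i, ∀ x ∈ A i, ∀ x' ∈ A i, f x = f x')
    (hg : ∀ j, ∀ y ∈ B j, ∀ y' ∈ B j, g y = g y')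
    (hfg : ∀ p ∈ optimalSupport ρ μ, f p.1 = g p.2) {i i' : I}
    (h : (supportGraph ρ μ A B).Reachable (Sum.inl i) (Sum.inl i')) {x x' : E} (hx : x ∈ A i)
    (hx' : x' ∈ A i') : f x' = f x := by
  let P : I ⊕ J → Prop :=
    Sum.elim (fun i => ∀ z ∈ A i, f z = f x) (fun j => ∀ z ∈ B j, g z = f x)
  have hadj : ∀ u v, (supportGraph ρ μ A B).Adj u v → P u → P v := by
    rintro u v ⟨i, j, huv, γ, hγ, hpos⟩ hu
    -- A set of positive outer measure meets the support, so `A i` and `B j` need not be measurable.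
    obtain ⟨p, hp, hps⟩ := Measure.nonempty_inter_support_of_pos hpos
    have hp' := hfg p ⟨γ, hγ, hps⟩
    rcases huv with ⟨rfl, rfl⟩ | ⟨rfl, rfl⟩
    · exact fun z hz => (hg j z hz p.2 hp.2).trans (hp'.symm.trans (hu p.1 hp.1))
    · exact fun z hz => (hf i z hz p.1 hp.1).trans (hp'.trans (hu p.2 hp.2))
  have hwalk : ∀ u v, (supportGraph ρ μ A B).Walk u v → P u → P v := by
    intro u v w
    induction w with
    | nil => exact id
    | cons h _ ih => exact fun hu => ih (hadj _ _ h hu)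
  obtain ⟨w⟩ := h
  exact hwalk _ _ w (fun z hz => hf i z hz x hx) x' hx'

variable [InnerProductSpace ℝ E] [FiniteDimensional ℝ E] [BorelSpace E]

/-- The bound of the distance of two Brenier potentials modulo constants by a single pair of points
of the supports of optimal plans, one in each component. -/
theorem iInf_uniformNorm_le [IsProbabilityMeasure ρ] [IsProbabilityMeasure μ] {X Y : Set E}
    (hX : IsCompact X) (hY : IsCompact Y) (hρX : ρ.support ⊆ X) (hμY : μ.support ⊆ Y)
    (hA : ∀ i, IsLipschitzPathConnected (A i)) (hB : ∀ j, IsLipschitzPathConnected (B j))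
    (hAρ : ρ.support = ⋃ i, A i) (hBμ : μ.support = ⋃ j, B j)
    {G₀ G₁ : (supportGraph ρ μ A B).ConnectedComponent} (htwo : ∀ C, C = G₀ ∨ C = G₁)
    {φ₀ φ₁ : E → ℝ} (hφ₀ : IsBrenierPotential ρ μ X Y φ₀) (hφ₁ : IsBrenierPotential ρ μ X Y φ₁)
    {p₀ p₁ : E × E} (hp₀ : p₀ ∈ supportPairs ρ μ A B G₀) (hp₁ : p₁ ∈ supportPairs ρ μ A B G₁) :
    (⨅ l : ℝ, uniformNorm ρ.support (fun x => φ₀ x - φ₁ x - l)) ≤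
      ((1 / 2 * inner ℝ (p₁.1 - p₀.1) (p₁.2 - p₀.2) : ℝ) : EReal) := by
  obtain ⟨ψ₀, hψ₀, hmin₀, hφ₀⟩ := hφ₀
  obtain ⟨ψ₁, hψ₁, hmin₁, hφ₁⟩ := hφ₁
  obtain ⟨hs₀, ⟨i₀, hi₀, hx₀⟩, -⟩ := hp₀
  obtain ⟨hs₁, ⟨i₁, hi₁, hx₁⟩, -⟩ := hp₁
  have haeX : ∀ᵐ x ∂ρ, x ∈ X := Filter.mem_of_superset Measure.support_mem_ae hρX
  have haeY : ∀ᵐ y ∂μ, y ∈ Y := Filter.mem_of_superset Measure.support_mem_ae hμY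
  have hρc : IsCompact ρ.support := hX.of_isClosed_subset Measure.isClosed_support hρX
  have hμc : IsCompact μ.support := hY.of_isClosed_subset Measure.isClosed_support hμY
  have hmemXY : ∀ p ∈ optimalSupport ρ μ, p ∈ X ×ˢ Y := by
    rintro p ⟨γ, hγ, hp⟩
    exact prod_mono hρX hμY (hγ.1.support_subset hp)
  have hc₀ : ∀ p ∈ optimalSupport ρ μ, legendre Y ψ₀ p.1 + ψ₀ p.2 = inner ℝ p.1 p.2 :=
    fun p hp => hp.elim fun γ h =>
      h.1.legendre_add_eq_inner hX hY haeX haeY hψ₀ hmin₀ h.2 (hmemXY p hp)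
  have hc₁ : ∀ p ∈ optimalSupport ρ μ, legendre Y ψ₁ p.1 + ψ₁ p.2 = inner ℝ p.1 p.2 :=
    fun p hp => hp.elim fun γ h =>
      h.1.legendre_add_eq_inner hX hY haeX haeY hψ₁ hmin₁ h.2 (hmemXY p hp)
  obtain ⟨RX, hRX⟩ := hX.isBounded.exists_norm_le
  obtain ⟨RY, hRY⟩ := hY.isBounded.exists_norm_le
  -- A single optimal plan supplies common subgradients at all points of both supports.
  obtain ⟨γ, hγ, -⟩ := id hs₀
  have hD : ∀ i, ∀ x ∈ A i, ∀ x' ∈ A i,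
      legendre Y ψ₀ x - legendre Y ψ₁ x = legendre Y ψ₀ x' - legendre Y ψ₁ x' := by
    intro i x hx x' hx'
    refine (hA i).sub_eq_sub (R := RY.toNNReal) (hAρ ▸ subset_iUnion A i) (fun z hz => ?_) hx hx'
    obtain ⟨y, hy⟩ := hγ.1.exists_mem_support_left hρc hμc hz
    have hzy : (z, y) ∈ optimalSupport ρ μ := ⟨γ, hγ, hy⟩
    have hyY : y ∈ Y := (hmemXY _ hzy).2
    exact ⟨y, (hRY y hyY).trans (Real.le_coe_toNNReal RY),
      isSubgradientOn_legendre hY hψ₀ hyY (hc₀ _ hzy) _,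
      isSubgradientOn_legendre hY hψ₁ hyY (hc₁ _ hzy) _⟩
  have hD' : ∀ j, ∀ y ∈ B j, ∀ y' ∈ B j, ψ₁ y - ψ₀ y = ψ₁ y' - ψ₀ y' := by
    intro j y hy y' hy'
    refine (hB j).sub_eq_sub (R := RX.toNNReal) (hBμ ▸ subset_iUnion B j) (fun z hz => ?_) hy hy'
    obtain ⟨x, hx⟩ := hγ.1.exists_mem_support_right hρc hμc hz
    have hxz : (x, z) ∈ optimalSupport ρ μ := ⟨γ, hγ, hx⟩
    exact ⟨x, (hRX x (hmemXY _ hxz).1).trans (Real.le_coe_toNNReal RX),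
      isSubgradientOn_of_legendre hY hψ₁ (hc₁ _ hxz) hμY,
      isSubgradientOn_of_legendre hY hψ₀ (hc₀ _ hxz) hμY⟩
  have hcomp : ∀ {C : (supportGraph ρ μ A B).ConnectedComponent} {i i' : I} {x x' : E},
      Sum.inl i ∈ C.supp → Sum.inl i' ∈ C.supp → x ∈ A i → x' ∈ A i' →
      legendre Y ψ₀ x' - legendre Y ψ₁ x' = legendre Y ψ₀ x - legendre Y ψ₁ x :=
    fun hi hi' hx hx' => eq_of_reachable (f := fun x => legendre Y ψ₀ x - legendre Y ψ₁ x)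
      (g := fun y => ψ₁ y - ψ₀ y) hD hD' (fun p hp => by linarith [hc₀ p hp, hc₁ p hp])
      (SimpleGraph.ConnectedComponent.exact (hi.trans hi'.symm)) hx hx'
  set c₀ := legendre Y ψ₀ p₀.1 - legendre Y ψ₁ p₀.1
  set c₁ := legendre Y ψ₀ p₁.1 - legendre Y ψ₁ p₁.1
  have hc : |c₀ - c₁| ≤ inner ℝ (p₁.1 - p₀.1) (p₁.2 - p₀.2) := by
    have a₀ := inner_sub_le_legendre hY hψ₀ p₁.1 (hmemXY _ hs₀).2
    have a₁ := inner_sub_le_legendre hY hψ₁ p₁.1 (hmemXY _ hs₀).2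
    have b₀ := inner_sub_le_legendre hY hψ₀ p₀.1 (hmemXY _ hs₁).2
    have b₁ := inner_sub_le_legendre hY hψ₁ p₀.1 (hmemXY _ hs₁).2
    have e₀ := hc₀ _ hs₀
    have e₁ := hc₁ _ hs₀
    have e₂ := hc₀ _ hs₁
    have e₃ := hc₁ _ hs₁
    simp only [inner_sub_left, inner_sub_right]
    rw [abs_le]
    constructor <;> simp only [c₀, c₁] <;> linarith
  -- The midpoint is at distance `|c₀ - c₁| / 2` from both values.
  refine iInf_le_of_le ((c₀ + c₁) / 2) (iSup₂_le fun x hx => EReal.coe_le_coe_iff.2 ?_)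
  beta_reduce
  rw [hφ₀ x (hρX hx), hφ₁ x (hρX hx)]
  obtain ⟨i, hi⟩ := mem_iUnion.1 (hAρ ▸ hx)
  have hcases : legendre Y ψ₀ x - legendre Y ψ₁ x = c₀ ∨
      legendre Y ψ₀ x - legendre Y ψ₁ x = c₁ :=
    (htwo ((supportGraph ρ μ A B).connectedComponentMk (Sum.inl i))).imp
      (fun h => hcomp hi₀ h hx₀ hi) (fun h => hcomp hi₁ h hx₁ hi)
  have h1 := abs_le.1 hc
  rw [abs_le]
  rcases hcases with h | h <;> rw [h] <;> constructor <;> linarith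

end Components

end OptimalTransport

theorem mainTheorem12 {d : ℕ} (ρ μ : Measure (EuclideanSpace ℝ (Fin d)))
    [IsProbabilityMeasure ρ] [IsProbabilityMeasure μ]
    (X Y : Set (EuclideanSpace ℝ (Fin d))) (hX : IsCompact X) (hY : IsCompact Y)
    (hρX : ρ.support ⊆ X) (hμY : μ.support ⊆ Y)
    {I J : Type*} [Finite I] [Finite J]
    (A : I → Set (EuclideanSpace ℝ (Fin d))) (B : J → Set (EuclideanSpace ℝ (Fin d)))
    (hA : ∀ i, OptimalTransport.IsLipschitzPathConnected (A i))
    (hB : ∀ j, OptimalTransport.IsLipschitzPathConnected (B j))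
    (hAρ : ρ.support = ⋃ i, A i) (hBμ : μ.support = ⋃ j, B j)
    (G₀ G₁ : (OptimalTransport.supportGraph ρ μ A B).ConnectedComponent)
    (hne : G₀ ≠ G₁)
    (htwo : ∀ C : (OptimalTransport.supportGraph ρ μ A B).ConnectedComponent, C = G₀ ∨ C = G₁)
    (φ₀ φ₁ : EuclideanSpace ℝ (Fin d) → ℝ)
    (hφ₀ : OptimalTransport.IsBrenierPotential ρ μ X Y φ₀)
    (hφ₁ : OptimalTransport.IsBrenierPotential ρ μ X Y φ₁) :
    (⨅ l : ℝ, OptimalTransport.uniformNorm ρ.support (fun x => φ₀ x - φ₁ x - l)) ≤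
      ((1 / 2 : ℝ) : EReal) *
        ⨅ p₀ ∈ OptimalTransport.supportPairs ρ μ A B G₀,
          ⨅ p₁ ∈ OptimalTransport.supportPairs ρ μ A B G₁,
            ((inner ℝ (p₁.1 - p₀.1) (p₁.2 - p₀.2) : ℝ) : EReal) := by
  set L := ⨅ l : ℝ, OptimalTransport.uniformNorm ρ.support (fun x => φ₀ x - φ₁ x - l)
  -- Doubling the left side avoids moving `1/2` through the infima; an empty infimum is `⊤` and
  -- needs no separate case.
  have h2 : ((2 : ℝ) : EReal) * L ≤ ⨅ p₀ ∈ OptimalTransport.supportPairs ρ μ A B G₀,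
      ⨅ p₁ ∈ OptimalTransport.supportPairs ρ μ A B G₁,
        ((inner ℝ (p₁.1 - p₀.1) (p₁.2 - p₀.2) : ℝ) : EReal) := by
    refine le_iInf₂ fun p₀ hp₀ => le_iInf₂ fun p₁ hp₁ => ?_
    have h := OptimalTransport.iInf_uniformNorm_le hX hY hρX hμY hA hB hAρ hBμ htwo hφ₀ hφ₁ hp₀ hp₁
    refine (mul_le_mul_of_nonneg_left h (EReal.coe_nonneg.2 zero_le_two)).trans_eq ?_
    rw [← EReal.coe_mul]
    congr 1
    ring
  calc L = ((1 / 2 : ℝ) : EReal) * (((2 : ℝ) : EReal) * L) := by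
        rw [← mul_assoc, ← EReal.coe_mul]
        norm_num
    _ ≤ _ := mul_le_mul_of_nonneg_left h2 (EReal.coe_nonneg.2 (by norm_num))
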